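/- Let $Y_1,Y_2,\dots$ be i.i.d. real random variables such that $P(|Y_1|>x)\sim \ell(x)\,x^{-\alpha}$ as $x\to\infty$, where $\alpha\in(0,2)$ and $\ell$ is slowly varying at infinity, i.e. $\ell$ is positive and measurable on some half-line $[X,\infty)$ and $\ell(cx)/\ell(x)\to1$ as $x\to\infty$ for every $c>0$. Put $V_n=\sqrt{Y_1^2+\cdots+Y_n^2}$ and $\delta_{1,n}=Y_1/V_n$ (with $\delta_{1,n}=0$ where $V_n=0$). Then for every real $\gamma>1$ the moments $E|\delta_{1,n}|^{2\gamma}$ are finite and $$ \lim_{n\to\infty} n\,E|\delta_{1,n}|^{2\gamma}=\frac{\Gamma(\gamma-\alpha/2)}{\Gamma(\gamma)\,\Gamma(1-\alpha/2)}, $$ where $\Gamma$ is Euler's gamma function. -/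

import Mathlib

open Filter Topology MeasureTheory ProbabilityTheory Asymptotics

/-- `ℓ` is slowly varying at `∞`: it is positive and measurable on some half-line `[X, ∞)`, and
`ℓ (c * x) / ℓ x → 1` as `x → ∞` for every `c > 0`. -/
def SlowlyVarying (ℓ : ℝ → ℝ) : Prop :=
  (∃ X : ℝ, (∀ x, X ≤ x → 0 < ℓ x) ∧ Measurable (fun x : Set.Ici X => ℓ x)) ∧
    ∀ c : ℝ, 0 < c → Tendsto (fun x => ℓ (c * x) / ℓ x) atTop (𝓝 1)

/-- The self-normalizer `V_n = √(Y_1² + ⋯ + Y_n²)`. Sequences are indexed from `0`, so that the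
first `n` variables are `Y 0, …, Y (n - 1)`. -/
noncomputable def selfNormalizer {Ω : Type*} (Y : ℕ → Ω → ℝ) (n : ℕ) (ω : Ω) : ℝ :=
  Real.sqrt (∑ i ∈ Finset.range n, Y i ω ^ 2)

/-- The normalized variable `Y k / V_n`, equal to `0` where `V_n = 0`. With sequences indexed from
`0`, the variable written `δ_{1,n} = Y_1 / V_n` is `selfNormalized Y 0 n`. -/
noncomputable def selfNormalized {Ω : Type*} (Y : ℕ → Ω → ℝ) (k n : ℕ) (ω : Ω) : ℝ :=
  Y k ω / selfNormalizer Y n ω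

/-! Put X_i = Y_i², S_n = X_0 + ⋯ + X_{n-1} and β = α/2, so the moment is E (X_0/S_n)^γ. Writing
Γ(γ) S^(-γ) as ∫ s^(γ-1) e^(-sS) ds and using independence turns Γ(γ) E (X_0/S_n)^γ into ∫ A
φ^(n-1), where φ is the Laplace transform of X_0 and A(s) = s^(γ-1) E[X_0^γ e^(-sX_0)]
(`integral_div_sum_rpow_eq`).

With B = -φ', the function n B φ^(n-1) is the derivative of -φ^n, so it has mass close to 1
concentrated near 0. Hence n ∫ A φ^(n-1) tends to lim A/B at 0 (`tendsto_mul_integral_mul_pow`).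

Both s A(s) and s B(s) are asymptotic to constants times P(X_0 > 1/s), by dominated convergence
under a Potter bound. The tail, and with it ℓ, cancels in A/B, leaving Γ(γ-β)/Γ(1-β). -/

theorem integrableOn_rpow_mul_exp_neg_mul_Ioi {a r : ℝ} (ha : 0 < a) (hr : 0 < r) :
    IntegrableOn (fun t : ℝ => t ^ (a - 1) * Real.exp (-(r * t))) (Set.Ioi 0) := by
  have := integrableOn_rpow_mul_exp_neg_mul_rpow (p := 1) (s := a - 1) (b := r)
    (by linarith) one_pos hr
  simpa only [Real.rpow_one, neg_mul] using this

/-- The derivative of `u ↦ u ^ γ * exp (-u)`. -/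
noncomputable def derivRpowMulExpNeg (γ u : ℝ) : ℝ :=
  (γ * u ^ (γ - 1) - u ^ γ) * Real.exp (-u)

theorem measurable_derivRpowMulExpNeg (γ : ℝ) : Measurable (derivRpowMulExpNeg γ) := by
  unfold derivRpowMulExpNeg
  fun_prop

theorem hasDerivAt_rpow_mul_exp_neg {γ : ℝ} (hγ : 1 ≤ γ) (u : ℝ) :
    HasDerivAt (fun u : ℝ => u ^ γ * Real.exp (-u)) (derivRpowMulExpNeg γ u) u := by
  have h1 := Real.hasDerivAt_rpow_const (x := u) (p := γ) (Or.inr hγ)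
  have h2 := (hasDerivAt_neg u).exp
  refine (h1.mul h2).congr_deriv ?_
  unfold derivRpowMulExpNeg
  ring

theorem derivRpowMulExpNeg_mul_rpow {γ ρ u : ℝ} (hu : 0 < u) :
    derivRpowMulExpNeg γ u * u ^ (-ρ) =
      γ * (u ^ ((γ - ρ) - 1) * Real.exp (-(1 * u)))
        - u ^ ((γ - ρ + 1) - 1) * Real.exp (-(1 * u)) := by
  have e1 : u ^ ((γ - ρ) - 1) = u ^ (γ - 1) * u ^ (-ρ) := by
    rw [← Real.rpow_add hu]; ring_nf
  have e2 : u ^ ((γ - ρ + 1) - 1) = u ^ γ * u ^ (-ρ) := by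
    rw [← Real.rpow_add hu]; ring_nf
  rw [e1, e2, derivRpowMulExpNeg, one_mul]
  ring

theorem integrableOn_derivRpowMulExpNeg_mul_rpow {γ ρ : ℝ} (h : ρ < γ) :
    IntegrableOn (fun u => derivRpowMulExpNeg γ u * u ^ (-ρ)) (Set.Ioi 0) := by
  refine IntegrableOn.congr_fun ?_
    (fun u (hu : 0 < u) => (derivRpowMulExpNeg_mul_rpow hu).symm) measurableSet_Ioi
  exact ((integrableOn_rpow_mul_exp_neg_mul_Ioi (by linarith) one_pos).const_mul γ).sub
    (integrableOn_rpow_mul_exp_neg_mul_Ioi (by linarith) one_pos)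

theorem integrableOn_derivRpowMulExpNeg {γ : ℝ} (h : 0 < γ) :
    IntegrableOn (derivRpowMulExpNeg γ) (Set.Ioi 0) := by
  simpa using integrableOn_derivRpowMulExpNeg_mul_rpow (ρ := 0) h

/-- The two Gamma integrals give γ Γ(γ-ρ) - Γ(γ-ρ+1), which the functional equation reduces to one
term. -/
theorem integral_derivRpowMulExpNeg_mul_rpow {γ ρ : ℝ} (h : ρ < γ) :
    ∫ u in Set.Ioi 0, derivRpowMulExpNeg γ u * u ^ (-ρ) = ρ * Real.Gamma (γ - ρ) := by
  rw [setIntegral_congr_fun measurableSet_Ioi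
    (fun u (hu : 0 < u) => derivRpowMulExpNeg_mul_rpow (γ := γ) (ρ := ρ) hu),
    integral_sub ((integrableOn_rpow_mul_exp_neg_mul_Ioi (by linarith) one_pos).const_mul γ)
      (integrableOn_rpow_mul_exp_neg_mul_Ioi (by linarith) one_pos), integral_const_mul,
    Real.integral_rpow_mul_exp_neg_mul_Ioi (by linarith) one_pos,
    Real.integral_rpow_mul_exp_neg_mul_Ioi (by linarith) one_pos,
    Real.Gamma_add_one (by linarith)]
  simp only [div_one, Real.one_rpow, one_mul]
  ring

/-! ### Truncated moments as integrals of the tail -/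

section
variable {Ω : Type*} [MeasurableSpace Ω] {P : Measure Ω} [IsProbabilityMeasure P]

theorem antitone_measureReal_lt (X : Ω → ℝ) : Antitone (fun x : ℝ => P.real {ω | x < X ω}) :=
  fun _ _ hab => measureReal_mono fun _ hω => lt_of_le_of_lt hab hω

/-- Layer-cake formula: write Z^γ e^(-Z) as the integral of its derivative over (0, Z) and apply
Fubini. The derivative changes sign but is absolutely integrable. -/
theorem integral_rpow_mul_exp_neg_eq_integral_tail {Z : Ω → ℝ} (hZ : Measurable Z)
    (hZ0 : ∀ ω, 0 ≤ Z ω) {γ : ℝ} (hγ : 1 ≤ γ) :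
    ∫ ω, Z ω ^ γ * Real.exp (-Z ω) ∂P =
      ∫ u in Set.Ioi 0, derivRpowMulExpNeg γ u * P.real {ω | u < Z ω} := by
  have hint : IntegrableOn (derivRpowMulExpNeg γ) (Set.Ioi 0) :=
    integrableOn_derivRpowMulExpNeg (by linarith)
  have hset : MeasurableSet {p : Ω × ℝ | p.2 < Z p.1} :=
    measurableSet_lt measurable_snd (hZ.comp measurable_fst)
  have hF : Integrable (Function.uncurry fun (ω : Ω) (u : ℝ) =>
      {p : Ω × ℝ | p.2 < Z p.1}.indicator (fun p => derivRpowMulExpNeg γ p.2) (ω, u))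
      (P.prod (volume.restrict (Set.Ioi 0))) :=
    (hint.comp_snd P).indicator hset
  have hswap := integral_integral_swap hF
  convert hswap using 1
  · refine integral_congr_ae (Eventually.of_forall fun ω => ?_)
    have e1 : ∀ u : ℝ, {p : Ω × ℝ | p.2 < Z p.1}.indicator
        (fun p => derivRpowMulExpNeg γ p.2) (ω, u) =
        (Set.Iio (Z ω)).indicator (derivRpowMulExpNeg γ) u := fun u => rfl
    simp only [e1]
    rw [setIntegral_indicator measurableSet_Iio, Set.Ioi_inter_Iio,
      ← integral_Ioc_eq_integral_Ioo, ← intervalIntegral.integral_of_le (hZ0 ω),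
      intervalIntegral.integral_eq_sub_of_hasDerivAt
        (fun u _ => hasDerivAt_rpow_mul_exp_neg hγ u)]
    · rw [Real.zero_rpow (by linarith)]; simp
    · rw [intervalIntegrable_iff_integrableOn_Ioc_of_le (hZ0 ω)]
      exact hint.mono_set Set.Ioc_subset_Ioi_self
  · refine integral_congr_ae (Eventually.of_forall fun u => ?_)
    have e1 : ∀ ω : Ω, {p : Ω × ℝ | p.2 < Z p.1}.indicator
        (fun p => derivRpowMulExpNeg γ p.2) (ω, u) =
        {ω | u < Z ω}.indicator (fun _ => derivRpowMulExpNeg γ u) ω := fun ω => rfl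
    simp only [e1]
    rw [integral_indicator_const _ (measurableSet_lt measurable_const hZ), smul_eq_mul, mul_comm]

end

/-! ### Regularly varying tails and the Abelian theorem -/

/-- A Potter-type bound for antitone functions of regular variation. -/
theorem exists_potter_bound {G : ℝ → ℝ} (hG : Antitone G) (hpos : ∀ x, 0 < G x) (h1 : ∀ x, G x ≤ 1)
    {β ρ : ℝ} (hβρ : β < ρ) (hρ : 0 ≤ ρ)
    (hlim : Tendsto (fun x => G (2⁻¹ * x) / G x) atTop (𝓝 ((2⁻¹ : ℝ) ^ (-β)))) :
    ∃ C x₀ : ℝ, 0 < x₀ ∧ 0 ≤ C ∧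
      ∀ x, x₀ ≤ x → ∀ u, 0 < u → u ≤ 1 → G (u * x) ≤ C * u ^ (-ρ) * G x := by
  have hlt : (2⁻¹ : ℝ) ^ (-β) < 2 ^ ρ := by
    rw [Real.inv_rpow (by norm_num), Real.rpow_neg (by norm_num), inv_inv]
    exact Real.rpow_lt_rpow_of_exponent_lt (by norm_num) hβρ
  obtain ⟨x₁, hx₁⟩ := eventually_atTop.1 (hlim.eventually (gt_mem_nhds hlt))
  set x₀ := max x₁ 1 with hx₀
  have hx₀pos : 0 < x₀ := lt_of_lt_of_le one_pos (le_max_right _ _)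
  have hhalf : ∀ x, x₀ ≤ x → G (2⁻¹ * x) ≤ 2 ^ ρ * G x := fun x hx => by
    have := hx₁ x ((le_max_left _ _).trans hx)
    rw [div_lt_iff₀ (hpos x)] at this
    exact this.le
  -- The first entry pays for one halving, the second for arguments below 2x₀, where only G ≤ 1 is
  -- used.
  set C := max ((2 : ℝ) ^ ρ) (1 / G (2 * x₀))
  have hC0 : 0 ≤ C := le_trans (by positivity) (le_max_left _ _)
  have hcrude : ∀ x, 0 < x → x ≤ 2 * x₀ → ∀ y, 0 < y → y ≤ x →
      y ^ ρ * G y ≤ C * (x ^ ρ * G x) := by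
    intro x hx0 hx y hy hyx
    have h2 : 1 ≤ C * G x :=
      calc (1 : ℝ) = 1 / G (2 * x₀) * G (2 * x₀) := by
            rw [one_div, inv_mul_cancel₀ (hpos _).ne']
        _ ≤ C * G x := mul_le_mul (le_max_right _ _) (hG hx) (hpos _).le hC0
    calc y ^ ρ * G y ≤ x ^ ρ * 1 :=
          mul_le_mul (Real.rpow_le_rpow hy.le hyx hρ) (h1 y) (hpos y).le (by positivity)
      _ ≤ x ^ ρ * (C * G x) := by gcongr
      _ = C * (x ^ ρ * G x) := by ring
  -- x^ρ G(x) is increasing up to the factor C. Induction on dyadic scales: passing from x to x/2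
  -- does not increase x^ρ G(x), so C does not grow with k.
  have key : ∀ k : ℕ, ∀ x, x₀ ≤ x → x ≤ 2 ^ k * x₀ → ∀ y, 0 < y → y ≤ x →
      y ^ ρ * G y ≤ C * (x ^ ρ * G x) := by
    intro k
    induction k with
    | zero =>
      intro x hx hxk y hy hyx
      exact hcrude x (hx₀pos.trans_le hx) (by simp at hxk; linarith) y hy hyx
    | succ k ih =>
      intro x hx hxk y hy hyx
      have hx0 : 0 < x := hx₀pos.trans_le hx
      rcases le_or_gt y (2⁻¹ * x) with hy2 | hy2
      · rcases le_or_gt x₀ (2⁻¹ * x) with hx2 | hx2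
        · refine (ih (2⁻¹ * x) hx2 (by rw [pow_succ] at hxk; linarith) y hy hy2).trans ?_
          refine mul_le_mul_of_nonneg_left ?_ hC0
          calc (2⁻¹ * x) ^ ρ * G (2⁻¹ * x) ≤ (2⁻¹ * x) ^ ρ * (2 ^ ρ * G x) := by
                gcongr; exact hhalf x hx
            _ = x ^ ρ * G x := by
                rw [← mul_assoc, ← Real.mul_rpow (by positivity) (by norm_num)]
                congr 2; ring
        · exact hcrude x hx0 (by linarith) y hy hyx
      · calc y ^ ρ * G y ≤ x ^ ρ * (C * G x) := by
              refine mul_le_mul (Real.rpow_le_rpow hy.le hyx hρ) ?_ (hpos y).le (by positivity)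
              exact (hG hy2.le).trans ((hhalf x hx).trans
                (mul_le_mul_of_nonneg_right (le_max_left _ _) (hpos x).le))
          _ = C * (x ^ ρ * G x) := by ring
  refine ⟨C, x₀, hx₀pos, hC0, fun x hx u hu hu1 => ?_⟩
  have hx0 : 0 < x := hx₀pos.trans_le hx
  obtain ⟨k, hk⟩ := pow_unbounded_of_one_lt (x / x₀) (one_lt_two (α := ℝ))
  have := key k x hx ((div_lt_iff₀ hx₀pos).1 hk).le (u * x) (by positivity)
    (by nlinarith)
  rw [Real.mul_rpow hu.le hx0.le] at this
  have hxp : 0 < x ^ ρ := by positivity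
  have hup : 0 < u ^ ρ := by positivity
  rw [Real.rpow_neg hu.le]
  have h3 : u ^ ρ * G (u * x) ≤ C * G x := by
    refine le_of_mul_le_mul_left ?_ hxp
    linarith
  calc G (u * x) = (u ^ ρ)⁻¹ * (u ^ ρ * G (u * x)) := by
        rw [← mul_assoc, inv_mul_cancel₀ hup.ne', one_mul]
    _ ≤ (u ^ ρ)⁻¹ * (C * G x) := by gcongr
    _ = C * (u ^ ρ)⁻¹ * G x := by ring

section
variable {Ω : Type*} [MeasurableSpace Ω] {P : Measure Ω} [IsProbabilityMeasure P]

/-- An Abelian theorem for the truncated moments of a variable with a regularly varying tail. -/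
theorem tendsto_integral_rpow_mul_exp_neg_div_tail {X : Ω → ℝ} (hX : Measurable X)
    (hX0 : ∀ ω, 0 ≤ X ω) (hpos : ∀ x, 0 < P.real {ω | x < X ω}) {β : ℝ} (hβ : 0 < β) (hβ1 : β < 1)
    (hlim : ∀ c, 0 < c → Tendsto (fun x => P.real {ω | c * x < X ω} / P.real {ω | x < X ω}) atTop
      (𝓝 (c ^ (-β)))) {γ : ℝ} (hγ : 1 ≤ γ) :
    Tendsto (fun s => (∫ ω, (s * X ω) ^ γ * Real.exp (-(s * X ω)) ∂P) / P.real {ω | s⁻¹ < X ω})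
      (𝓝[>] 0) (𝓝 (β * Real.Gamma (γ - β))) := by
  set G : ℝ → ℝ := fun x => P.real {ω | x < X ω} with hGdef
  have hG : Antitone G := antitone_measureReal_lt X
  -- Strictly between β, as the Potter bound needs, and 1 ≤ γ, as integrability of the dominating
  -- function near 0 needs.
  set ρ := (β + 1) / 2 with hρ
  obtain ⟨C, x₀, hx₀, hC, hpot⟩ := exists_potter_bound hG hpos (fun x => measureReal_le_one)
    (β := β) (ρ := ρ) (by linarith) (by linarith) (hlim 2⁻¹ (by norm_num))
  have hdct : Tendsto (fun x => ∫ u in Set.Ioi 0, derivRpowMulExpNeg γ u * (G (u * x) / G x))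
      atTop (𝓝 (∫ u in Set.Ioi 0, derivRpowMulExpNeg γ u * u ^ (-β))) := by
    refine tendsto_integral_filter_of_dominated_convergence
      (fun u => C * ‖derivRpowMulExpNeg γ u * u ^ (-ρ)‖ + ‖derivRpowMulExpNeg γ u‖) ?_ ?_ ?_ ?_
    · filter_upwards [eventually_gt_atTop 0] with x hx
      have : Measurable fun u => G (u * x) := hG.measurable.comp (measurable_id.mul_const x)
      exact ((measurable_derivRpowMulExpNeg γ).mul (this.div_const _)).aestronglyMeasurable
    · filter_upwards [eventually_ge_atTop x₀] with x hx
      filter_upwards [ae_restrict_mem measurableSet_Ioi] with u hu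
      have hu : 0 < u := hu
      have hx0 : 0 < x := hx₀.trans_le hx
      -- The Potter bound covers u ≤ 1, monotonicity of G covers u ≥ 1.
      have hb : G (u * x) / G x ≤ C * u ^ (-ρ) + 1 := by
        rw [div_le_iff₀ (hpos x)]
        have hup : 0 < u ^ (-ρ) := by positivity
        rcases le_total u 1 with h | h
        · exact (hpot x hx u hu h).trans (mul_le_mul_of_nonneg_right (by linarith) (hpos x).le)
        · have h1 : G (u * x) ≤ G x := hG (by nlinarith)
          have h2 : 0 ≤ C * u ^ (-ρ) * G x := mul_nonneg (by positivity) (hpos x).le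
          linarith
      have hn : 0 ≤ G (u * x) / G x := div_nonneg (hpos _).le (hpos _).le
      rw [norm_mul, norm_mul, Real.norm_of_nonneg hn,
        Real.norm_of_nonneg (Real.rpow_nonneg hu.le _)]
      calc _ ≤ ‖derivRpowMulExpNeg γ u‖ * (C * u ^ (-ρ) + 1) := by gcongr
        _ = _ := by ring
    · exact ((integrableOn_derivRpowMulExpNeg_mul_rpow (by linarith)).norm.const_mul C).add
        (integrableOn_derivRpowMulExpNeg (by linarith)).norm
    · filter_upwards [ae_restrict_mem measurableSet_Ioi] with u hu
      exact (hlim u hu).const_mul _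
  rw [integral_derivRpowMulExpNeg_mul_rpow (by linarith)] at hdct
  refine (hdct.comp tendsto_inv_nhdsGT_zero).congr' ?_
  filter_upwards [self_mem_nhdsWithin] with s hs
  have hs : 0 < s := hs
  rw [integral_rpow_mul_exp_neg_eq_integral_tail (hX.const_mul s)
    (fun ω => mul_nonneg hs.le (hX0 ω)) hγ, ← integral_div]
  refine setIntegral_congr_fun measurableSet_Ioi fun u _ => ?_
  have : {ω | u < s * X ω} = {ω | u * s⁻¹ < X ω} := by
    ext ω
    simp only [Set.mem_ofPred_eq]
    rw [← div_eq_mul_inv, div_lt_iff₀' hs]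
  simp only [this, hGdef, mul_div_assoc]

/-- Divide the Abelian limit for γ by the one for exponent 1: the tail and the factor β cancel. -/
theorem tendsto_ratio_integral_rpow_mul_exp_neg {X : Ω → ℝ} (hX : Measurable X)
    (hX0 : ∀ ω, 0 ≤ X ω) (hpos : ∀ x, 0 < P.real {ω | x < X ω}) {β : ℝ} (hβ : 0 < β) (hβ1 : β < 1)
    (hlim : ∀ c, 0 < c → Tendsto (fun x => P.real {ω | c * x < X ω} / P.real {ω | x < X ω}) atTop
      (𝓝 (c ^ (-β)))) {γ : ℝ} (hγ : 1 ≤ γ) :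
    Tendsto (fun s => (s ^ (γ - 1) * ∫ ω, X ω ^ γ * Real.exp (-(s * X ω)) ∂P) /
        ∫ ω, X ω * Real.exp (-(s * X ω)) ∂P)
      (𝓝[>] 0) (𝓝 (Real.Gamma (γ - β) / Real.Gamma (1 - β))) := by
  have h1 := tendsto_integral_rpow_mul_exp_neg_div_tail hX hX0 hpos hβ hβ1 hlim hγ
  have h2 := tendsto_integral_rpow_mul_exp_neg_div_tail hX hX0 hpos hβ hβ1 hlim le_rfl
  have hΓ : 0 < Real.Gamma (1 - β) := Real.Gamma_pos_of_pos (by linarith)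
  have h3 := h1.div h2 (by positivity)
  rw [mul_div_mul_left _ _ hβ.ne'] at h3
  refine h3.congr' ?_
  filter_upwards [self_mem_nhdsWithin] with s hs
  have hs : 0 < s := hs
  have e1 : ∫ ω, (s * X ω) ^ γ * Real.exp (-(s * X ω)) ∂P =
      s * (s ^ (γ - 1) * ∫ ω, X ω ^ γ * Real.exp (-(s * X ω)) ∂P) := by
    rw [← mul_assoc, ← integral_const_mul]
    congr with ω
    rw [Real.mul_rpow hs.le (hX0 ω)]
    have : s * s ^ (γ - 1) = s ^ γ := by
      rw [mul_comm, ← Real.rpow_add_one hs.ne', sub_add_cancel]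
    rw [this, mul_assoc]
  have e2 : ∫ ω, (s * X ω) ^ (1 : ℝ) * Real.exp (-(s * X ω)) ∂P =
      s * ∫ ω, X ω * Real.exp (-(s * X ω)) ∂P := by
    rw [← integral_const_mul]
    congr with ω
    rw [Real.rpow_one, mul_assoc]
  rw [Pi.div_apply, e1, e2, div_div_div_cancel_right₀ (hpos _).ne', mul_div_mul_left _ _ hs.ne']

end

/-! ### Concentration of the integral at the origin -/

/-- A Laplace-type limit: mass of `A * φ ^ n` concentrates at `0`, where `A` is comparable with
`-φ'`. -/
theorem tendsto_mul_integral_mul_pow {A B φ : ℝ → ℝ} {R : ℝ} (hφ : ContinuousOn φ (Set.Ici 0))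
    (hφ0 : φ 0 = 1) (hφnn : ∀ s, 0 ≤ s → 0 ≤ φ s) (hanti : AntitoneOn φ (Set.Ici 0))
    (hlt : ∀ s, 0 < s → φ s < 1) (hder : ∀ s, 0 < s → HasDerivAt φ (-B s) s)
    (hB : ∀ s, 0 < s → 0 ≤ B s) (hA0 : ∀ s, 0 < s → 0 ≤ A s) (hA : IntegrableOn A (Set.Ioi 0))
    (hAn : ∀ n : ℕ, IntegrableOn (fun s => A s * φ s ^ n) (Set.Ioi 0))
    (h : ∀ ε > 0, ∀ᶠ s in 𝓝[>] 0, |A s - R * B s| ≤ ε * B s) :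
    Tendsto (fun n : ℕ => ((n : ℝ) + 1) * ∫ s in Set.Ioi 0, A s * φ s ^ n) atTop (𝓝 R) := by
  rw [Metric.tendsto_atTop']
  intro ε hε
  obtain ⟨δ', hδ', hδ⟩ := mem_nhdsGT_iff_exists_Ioc_subset.1 (h (ε / 2) (half_pos hε))
  have hδ'0 : (0 : ℝ) < δ' := hδ'
  set q := φ δ'
  have hq0 : 0 ≤ q := hφnn _ hδ'0.le
  have hq1 : q < 1 := hlt _ hδ'0
  set M := ∫ s in Set.Ioi 0, A s
  -- The integrand is the derivative of -φ^(n+1). Being nonnegative, it is integrable up to 0 even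
  -- if B blows up there.
  have hBn : ∀ n : ℕ, IntegrableOn (fun s => ((n : ℝ) + 1) * (B s * φ s ^ n)) (Set.Ioc 0 δ') ∧
      ∫ s in Set.Ioc 0 δ', ((n : ℝ) + 1) * (B s * φ s ^ n) = 1 - q ^ (n + 1) := by
    intro n
    have hc : ContinuousOn (fun s => -φ s ^ (n + 1)) (Set.Icc 0 δ') :=
      ((hφ.mono Set.Icc_subset_Ici_self).pow _).neg
    have hd : ∀ s ∈ Set.Ioo 0 δ', HasDerivAt (fun s => -φ s ^ (n + 1))
        (((n : ℝ) + 1) * (B s * φ s ^ n)) s := by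
      intro s hs
      refine ((hder s hs.1).pow (n + 1)).neg.congr_deriv ?_
      rw [Nat.add_sub_cancel]
      push_cast
      ring
    have hi := intervalIntegral.integrableOn_deriv_of_nonneg hc hd
      (fun s hs => mul_nonneg (by positivity)
        (mul_nonneg (hB s hs.1) (pow_nonneg (hφnn s hs.1.le) _)))
    refine ⟨hi, ?_⟩
    rw [← intervalIntegral.integral_of_le hδ'0.le,
      intervalIntegral.integral_eq_sub_of_hasDerivAt_of_le hδ'0.le hc hd
        ((intervalIntegrable_iff_integrableOn_Ioc_of_le hδ'0.le).2 hi), hφ0]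
    simp only [one_pow]
    ring
  have hnear : ∀ n : ℕ, |((n : ℝ) + 1) * (∫ s in Set.Ioc 0 δ', A s * φ s ^ n)
      - R * (1 - q ^ (n + 1))| ≤ ε / 2 := by
    intro n
    obtain ⟨hi, he⟩ := hBn n
    have hAi :=
      ((hAn n).mono_set (Set.Ioc_subset_Ioi_self (a := δ') (b := 0))).const_mul ((n : ℝ) + 1)
    rw [← he, ← integral_const_mul, ← integral_const_mul, ← integral_sub hAi (hi.const_mul R)]
    calc _ ≤ ∫ s in Set.Ioc 0 δ', ε / 2 * (((n : ℝ) + 1) * (B s * φ s ^ n)) := by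
          rw [← Real.norm_eq_abs]
          refine norm_integral_le_of_norm_le (hi.const_mul _) ?_
          filter_upwards [ae_restrict_mem measurableSet_Ioc] with s hs
          have h1 : |A s - R * B s| ≤ ε / 2 * B s := hδ hs
          have h2 : 0 ≤ ((n : ℝ) + 1) * φ s ^ n :=
            mul_nonneg (by positivity) (pow_nonneg (hφnn s hs.1.le) _)
          have h3 : ((n : ℝ) + 1) * (A s * φ s ^ n) - R * (((n : ℝ) + 1) * (B s * φ s ^ n)) =
              (((n : ℝ) + 1) * φ s ^ n) * (A s - R * B s) := by ring
          rw [h3, norm_mul, Real.norm_of_nonneg h2, Real.norm_eq_abs]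
          calc _ ≤ (((n : ℝ) + 1) * φ s ^ n) * (ε / 2 * B s) := by gcongr
            _ = _ := by ring
      _ = ε / 2 * (1 - q ^ (n + 1)) := by rw [integral_const_mul, he]
      _ ≤ ε / 2 * 1 := by
          gcongr
          linarith [pow_nonneg hq0 (n + 1)]
      _ = ε / 2 := mul_one _
  have hM0 : ∫ s in Set.Ioi δ', A s ≤ M :=
    setIntegral_mono_set hA ((ae_restrict_mem measurableSet_Ioi).mono fun s hs => hA0 s hs)
      (Set.Ioi_subset_Ioi hδ'0.le).eventuallyLE
  -- Beyond δ' we have φ ≤ q < 1, so this part decays geometrically.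
  have hfar : ∀ n : ℕ, |((n : ℝ) + 1) * ∫ s in Set.Ioi δ', A s * φ s ^ n|
      ≤ ((n : ℝ) + 1) * (q ^ n * M) := by
    intro n
    rw [abs_mul, abs_of_nonneg (by positivity : (0 : ℝ) ≤ (n : ℝ) + 1)]
    refine mul_le_mul_of_nonneg_left ?_ (by positivity)
    calc _ ≤ ∫ s in Set.Ioi δ', q ^ n * A s := by
          rw [← Real.norm_eq_abs]
          refine norm_integral_le_of_norm_le
            ((hA.mono_set (Set.Ioi_subset_Ioi hδ'0.le)).const_mul _) ?_
          filter_upwards [ae_restrict_mem measurableSet_Ioi] with s hs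
          have hs' : δ' < s := hs
          have hs0 : 0 < s := hδ'0.trans hs'
          have h1 := hφnn s hs0.le
          have h2 : φ s ≤ q := hanti hδ'0.le hs0.le hs'.le
          have h3 := hA0 s hs0
          rw [Real.norm_of_nonneg (by positivity), mul_comm]
          gcongr
      _ = q ^ n * ∫ s in Set.Ioi δ', A s := integral_const_mul _ _
      _ ≤ q ^ n * M := by gcongr
  have hsmall : Tendsto (fun n : ℕ => |R| * q ^ (n + 1) + ((n : ℝ) + 1) * (q ^ n * M)) atTop
      (𝓝 0) := by
    have t1 := tendsto_pow_atTop_nhds_zero_of_lt_one hq0 hq1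
    have t2 := tendsto_self_mul_const_pow_of_lt_one hq0 hq1
    have t3 := (((tendsto_add_atTop_iff_nat 1).2 t1).const_mul |R|).add
      ((t2.mul_const M).add (t1.mul_const M))
    simp only [mul_zero, zero_mul, add_zero] at t3
    refine t3.congr fun n => ?_
    ring
  obtain ⟨N, hN⟩ := eventually_atTop.1 (hsmall.eventually (gt_mem_nhds (half_pos hε)))
  refine ⟨N, fun n hn => ?_⟩
  have hsplit : ∫ s in Set.Ioi 0, A s * φ s ^ n =
      (∫ s in Set.Ioc 0 δ', A s * φ s ^ n) + ∫ s in Set.Ioi δ', A s * φ s ^ n := by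
    rw [← Set.Ioc_union_Ioi_eq_Ioi hδ'0.le]
    exact setIntegral_union (Set.Ioc_disjoint_Ioi le_rfl) measurableSet_Ioi
      ((hAn n).mono_set Set.Ioc_subset_Ioi_self)
      ((hAn n).mono_set (Set.Ioi_subset_Ioi hδ'0.le))
  rw [Real.dist_eq, hsplit]
  have a1 := hnear n
  have a2 := hfar n
  have a3 := hN n hn.le
  have a4 : |R * q ^ (n + 1)| = |R| * q ^ (n + 1) := by
    rw [abs_mul, abs_of_nonneg (pow_nonneg hq0 _)]
  generalize (∫ s in Set.Ioc 0 δ', A s * φ s ^ n) = I at *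
  generalize (∫ s in Set.Ioi δ', A s * φ s ^ n) = J at *
  have e : ((n : ℝ) + 1) * (I + J) - R = (((n : ℝ) + 1) * I - R * (1 - q ^ (n + 1)))
      + ((n : ℝ) + 1) * J - R * q ^ (n + 1) := by ring
  rw [e]
  have b1 := abs_sub (((n : ℝ) + 1) * I - R * (1 - q ^ (n + 1)) + ((n : ℝ) + 1) * J)
    (R * q ^ (n + 1))
  have b2 := abs_add_le (((n : ℝ) + 1) * I - R * (1 - q ^ (n + 1))) (((n : ℝ) + 1) * J)
  linarith

/-! ### The Laplace transform of a nonnegative variable -/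

section LaplaceTransform
variable {Ω : Type*} [MeasurableSpace Ω] {P : Measure Ω} [IsProbabilityMeasure P] {X : Ω → ℝ}

theorem integrable_exp_neg_mul (hX : Measurable X) (hX0 : ∀ ω, 0 ≤ X ω) {s : ℝ} (hs : 0 ≤ s) :
    Integrable (fun ω => Real.exp (-s * X ω)) P := by
  refine Integrable.of_bound (by fun_prop) 1 (Eventually.of_forall fun ω => ?_)
  rw [Real.norm_of_nonneg (Real.exp_pos _).le, Real.exp_le_one_iff]
  nlinarith [mul_nonneg hs (hX0 ω)]

theorem continuousOn_mgf_neg (hX : Measurable X) (hX0 : ∀ ω, 0 ≤ X ω) :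
    ContinuousOn (fun s => mgf X P (-s)) (Set.Ici 0) := by
  refine continuousOn_of_dominated (bound := fun _ => 1) (fun s _ => by fun_prop) ?_
    (integrable_const _) (Eventually.of_forall fun ω => by fun_prop)
  intro s hs
  refine Eventually.of_forall fun ω => ?_
  rw [Real.norm_of_nonneg (Real.exp_pos _).le, Real.exp_le_one_iff]
  nlinarith [mul_nonneg (show 0 ≤ s from hs) (hX0 ω)]

theorem antitoneOn_mgf_neg (hX : Measurable X) (hX0 : ∀ ω, 0 ≤ X ω) :
    AntitoneOn (fun s => mgf X P (-s)) (Set.Ici 0) := by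
  intro s hs t ht hst
  refine integral_mono (integrable_exp_neg_mul hX hX0 ht) (integrable_exp_neg_mul hX hX0 hs)
    fun ω => Real.exp_le_exp.2 ?_
  nlinarith [mul_le_mul_of_nonneg_right hst (hX0 ω)]

theorem mgf_neg_lt_one (hX : Measurable X) (hX0 : ∀ ω, 0 ≤ X ω)
    (hpos : 0 < P.real {ω | 0 < X ω}) {s : ℝ} (hs : 0 < s) : mgf X P (-s) < 1 := by
  have hi := integrable_exp_neg_mul (P := P) hX hX0 hs.le
  have hi1 : Integrable (fun ω => 1 - Real.exp (-s * X ω)) P := (integrable_const _).sub hi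
  have h1 : 0 < ∫ ω, (1 - Real.exp (-s * X ω)) ∂P := by
    rw [integral_pos_iff_support_of_nonneg ?_ hi1]
    · refine (ENNReal.toReal_pos_iff.1 hpos).1.trans_le
        (measure_mono fun ω (hω : 0 < X ω) => ?_)
      have : Real.exp (-s * X ω) < 1 := by
        rw [Real.exp_lt_one_iff]
        nlinarith [mul_pos hs hω]
      exact (sub_pos.2 this).ne'
    · intro ω
      have : Real.exp (-s * X ω) ≤ 1 := by
        rw [Real.exp_le_one_iff]
        nlinarith [mul_nonneg hs.le (hX0 ω)]
      exact sub_nonneg.2 this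
  rw [integral_sub (integrable_const _) hi] at h1
  simp only [integral_const, probReal_univ, one_smul] at h1
  have : mgf X P (-s) = ∫ ω, Real.exp (-s * X ω) ∂P := rfl
  linarith

/-- For s > 0 the point -s is interior to the domain of the mgf; at s = 0 the mean may be infinite.
-/
theorem hasDerivAt_mgf_neg (hX : Measurable X) (hX0 : ∀ ω, 0 ≤ X ω) {s : ℝ} (hs : 0 < s) :
    HasDerivAt (fun s => mgf X P (-s)) (-∫ ω, X ω * Real.exp (-(s * X ω)) ∂P) s := by
  have hmem : -s ∈ interior (integrableExpSet X P) := by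
    refine mem_interior.2 ⟨Set.Iio 0, fun t ht => ?_, isOpen_Iio, by simpa using hs⟩
    have := integrable_exp_neg_mul (P := P) hX hX0 (s := -t) (by simpa using le_of_lt ht)
    simpa [integrableExpSet] using this
  refine ((hasDerivAt_mgf hmem).comp s (hasDerivAt_neg s)).congr_deriv ?_
  simp

end LaplaceTransform

theorem div_sum_range_mem_Icc {Ω : Type*} {X : ℕ → Ω → ℝ}
    (hX0 : ∀ i ω, 0 ≤ X i ω) (m : ℕ) (ω : Ω) :
    X 0 ω / (∑ i ∈ Finset.range (m + 1), X i ω) ∈ Set.Icc (0 : ℝ) 1 := by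
  have h0 : 0 ≤ ∑ i ∈ Finset.range (m + 1), X i ω := Finset.sum_nonneg fun i _ => hX0 i ω
  exact ⟨div_nonneg (hX0 0 ω) h0, div_le_one_of_le₀ (Finset.single_le_sum
    (f := fun i => X i ω) (fun i _ => hX0 i ω) (by simp)) h0⟩

/-! ### Moments of X_0 divided by the sum -/

section SelfNormalizedSum
variable {Ω : Type*} [MeasurableSpace Ω] {P : Measure Ω} [IsProbabilityMeasure P] {X : ℕ → Ω → ℝ}

theorem integrable_div_sum_rpow (hX : ∀ i, Measurable (X i)) (hX0 : ∀ i ω, 0 ≤ X i ω)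
    {γ : ℝ} (hγ : 0 ≤ γ) (m : ℕ) :
    Integrable (fun ω => (X 0 ω / ∑ i ∈ Finset.range (m + 1), X i ω) ^ γ) P := by
  refine Integrable.of_bound (C := 1) ?_ (Eventually.of_forall fun ω => ?_)
  · have : Measurable fun ω => ∑ i ∈ Finset.range (m + 1), X i ω :=
      Finset.measurable_sum _ fun i _ => hX i
    exact (((hX 0).div this).pow_const γ).aestronglyMeasurable
  · obtain ⟨h1, h2⟩ := div_sum_range_mem_Icc hX0 m ω
    rw [Real.norm_of_nonneg (by positivity)]
    exact Real.rpow_le_one h1 h2 hγ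

/-- The Gamma-integral representation of moments of a self-normalized variable. -/
theorem integral_div_sum_rpow_eq (hX : ∀ i, Measurable (X i)) (hX0 : ∀ i ω, 0 ≤ X i ω)
    (hindep : iIndepFun X P) (hident : ∀ i, IdentDistrib (X i) (X 0) P P)
    {γ : ℝ} (hγ : 0 < γ) (m : ℕ) :
    IntegrableOn (fun s => (s ^ (γ - 1) * ∫ ω, X 0 ω ^ γ * Real.exp (-(s * X 0 ω)) ∂P)
        * mgf (X 0) P (-s) ^ m) (Set.Ioi 0) ∧
      ∫ s in Set.Ioi 0, (s ^ (γ - 1) * ∫ ω, X 0 ω ^ γ * Real.exp (-(s * X 0 ω)) ∂P)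
        * mgf (X 0) P (-s) ^ m =
      Real.Gamma γ * ∫ ω, (X 0 ω / ∑ i ∈ Finset.range (m + 1), X i ω) ^ γ ∂P := by
  have hS : Measurable fun ω => ∑ i ∈ Finset.range (m + 1), X i ω :=
    Finset.measurable_sum _ fun i _ => hX i
  set S : Ω → ℝ := fun ω => ∑ i ∈ Finset.range (m + 1), X i ω
  set F : Ω → ℝ → ℝ := fun ω s => X 0 ω ^ γ * (s ^ (γ - 1) * Real.exp (-(S ω * s))) with hF
  -- The Gamma integral needs S > 0. Where S may vanish, X_0 = 0 and both sides are 0 because γ > 0.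
  have hcase : ∀ ω, (X 0 ω = 0 ∧ (∀ s, F ω s = 0)) ∨ 0 < S ω := by
    intro ω
    rcases (hX0 0 ω).eq_or_lt with h | h
    · left
      refine ⟨h.symm, fun s => ?_⟩
      simp only [hF]
      rw [← h, Real.zero_rpow hγ.ne', zero_mul]
    · right
      exact h.trans_le (Finset.single_le_sum (f := fun i => X i ω) (fun i _ => hX0 i ω) (by simp))
  have hFint : ∀ ω, IntegrableOn (F ω) (Set.Ioi 0) := by
    intro ω
    rcases hcase ω with ⟨_, h⟩ | h
    · rw [funext h]; exact integrableOn_zero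
    · exact (integrableOn_rpow_mul_exp_neg_mul_Ioi hγ h).const_mul _
  have hFval : ∀ ω, ∫ s in Set.Ioi 0, F ω s = Real.Gamma γ * (X 0 ω / S ω) ^ γ := by
    intro ω
    rcases hcase ω with ⟨h0, h⟩ | h
    · simp [h, h0, Real.zero_rpow hγ.ne']
    · simp only [hF]
      rw [integral_const_mul, Real.integral_rpow_mul_exp_neg_mul_Ioi hγ h,
        div_eq_mul_one_div (X 0 ω), Real.mul_rpow (hX0 0 ω) (by positivity)]
      ring
  have hFnn : ∀ ω, ∀ s ∈ Set.Ioi (0 : ℝ), 0 ≤ F ω s := fun ω s hs =>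
    mul_nonneg (Real.rpow_nonneg (hX0 0 ω) _)
      (mul_nonneg (Real.rpow_nonneg (le_of_lt hs) _) (Real.exp_pos _).le)
  have hratio : Integrable (fun ω => (X 0 ω / S ω) ^ γ) P := integrable_div_sum_rpow hX hX0 hγ.le m
  have hX00 := hX 0
  -- F is nonnegative, so the inner integral of its norm is Γ(γ) times a bounded ratio.
  have hprod : Integrable (Function.uncurry F) (P.prod (volume.restrict (Set.Ioi 0))) := by
    have hm : Measurable (Function.uncurry F) := by
      simp only [hF, Function.uncurry_def]
      fun_prop
    rw [integrable_prod_iff hm.aestronglyMeasurable]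
    refine ⟨Eventually.of_forall hFint, ?_⟩
    refine (hratio.const_mul (Real.Gamma γ)).congr (Eventually.of_forall fun ω => ?_)
    simp only [← hFval]
    refine setIntegral_congr_fun measurableSet_Ioi fun s hs => ?_
    exact (Real.norm_of_nonneg (hFnn ω s hs)).symm
  have hinner : ∀ s, ∫ ω, F ω s ∂P = (s ^ (γ - 1) *
      ∫ ω, X 0 ω ^ γ * Real.exp (-(s * X 0 ω)) ∂P) * mgf (X 0) P (-s) ^ m := by
    intro s
    have hind : IndepFun (X 0) (∑ i ∈ Finset.Ioc 0 m, X i) P :=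
      (hindep.indepFun_finsetSum_of_notMem hX (by simp)).symm
    have hind2 := hind.comp (φ := fun x : ℝ => x ^ γ * Real.exp (-(s * x)))
      (ψ := fun x : ℝ => Real.exp (-s * x)) (by fun_prop) (by fun_prop)
    have hsum : Measurable (∑ i ∈ Finset.Ioc 0 m, X i) :=
      by
      rw [Finset.sum_fn]; exact Finset.measurable_sum _ fun i _ => hX i
    have hmgf : ∫ ω, Real.exp (-s * (∑ i ∈ Finset.Ioc 0 m, X i) ω) ∂P = mgf (X 0) P (-s) ^ m := by
      have h1 := hindep.mgf_sum hX (Finset.Ioc 0 m) (t := -s)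
      rw [Finset.prod_congr rfl fun i _ => by rw [mgf_congr_identDistrib (hident i)],
        Finset.prod_const, Nat.card_Ioc, Nat.sub_zero] at h1
      exact h1
    have hmul := hind2.integral_fun_mul_eq_mul_integral
      (Measurable.aestronglyMeasurable (by fun_prop))
      (Measurable.aestronglyMeasurable (by fun_prop))
    simp only [Function.comp_apply] at hmul
    rw [hmgf] at hmul
    rw [mul_assoc, ← hmul, ← integral_const_mul]
    congr with ω
    have hSsplit : S ω = X 0 ω + (∑ i ∈ Finset.Ioc 0 m, X i) ω := by
      rw [Finset.sum_apply]
      have : Finset.range (m + 1) = insert 0 (Finset.Ioc 0 m) := by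
        ext i; simp
      simp only [S, this, Finset.sum_insert Finset.left_notMem_Ioc]
    have hexp : Real.exp (-(S ω * s)) =
        Real.exp (-(s * X 0 ω)) * Real.exp (-s * (∑ i ∈ Finset.Ioc 0 m, X i) ω) := by
      rw [← Real.exp_add, hSsplit]
      congr 1
      ring
    simp only [hF, hexp]
    ring
  constructor
  · have := hprod.integral_prod_right
    simpa only [Function.uncurry_apply_pair, hinner, IntegrableOn] using this
  · simp only [← hinner]
    rw [← integral_integral_swap hprod, ← integral_const_mul]
    exact integral_congr_ae (Eventually.of_forall hFval)

theorem tendsto_nat_mul_integral_div_sum_rpow (hX : ∀ i, Measurable (X i))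
    (hX0 : ∀ i ω, 0 ≤ X i ω) (hindep : iIndepFun X P)
    (hident : ∀ i, IdentDistrib (X i) (X 0) P P)
    (hpos : ∀ x, 0 < P.real {ω | x < X 0 ω}) {β : ℝ} (hβ : 0 < β) (hβ1 : β < 1)
    (hlim : ∀ c, 0 < c → Tendsto
      (fun x => P.real {ω | c * x < X 0 ω} / P.real {ω | x < X 0 ω}) atTop (𝓝 (c ^ (-β))))
    {γ : ℝ} (hγ : 1 ≤ γ) :
    Tendsto (fun m : ℕ => ((m : ℝ) + 1) *
        ∫ ω, (X 0 ω / ∑ i ∈ Finset.range (m + 1), X i ω) ^ γ ∂P) atTop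
      (𝓝 (Real.Gamma (γ - β) / (Real.Gamma γ * Real.Gamma (1 - β)))) := by
  have hγ0 : 0 < γ := by linarith
  have hrep := integral_div_sum_rpow_eq hX hX0 hindep hident hγ0
  set A : ℝ → ℝ := fun s => s ^ (γ - 1) * ∫ ω, X 0 ω ^ γ * Real.exp (-(s * X 0 ω)) ∂P with hA
  set B : ℝ → ℝ := fun s => ∫ ω, X 0 ω * Real.exp (-(s * X 0 ω)) ∂P with hB
  have hBnn : ∀ s, 0 ≤ B s := fun s =>
    integral_nonneg fun ω => mul_nonneg (hX0 0 ω) (Real.exp_pos _).le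
  set R := Real.Gamma (γ - β) / Real.Gamma (1 - β) with hR
  have hRpos : 0 < R :=
    div_pos (Real.Gamma_pos_of_pos (by linarith)) (Real.Gamma_pos_of_pos (by linarith))
  have hratio : Tendsto (fun s => A s / B s) (𝓝[>] 0) (𝓝 R) :=
    tendsto_ratio_integral_rpow_mul_exp_neg (hX 0) (hX0 0) hpos hβ hβ1 hlim hγ
  have hmain : Tendsto (fun m : ℕ => ((m : ℝ) + 1) *
      ∫ s in Set.Ioi 0, A s * mgf (X 0) P (-s) ^ m) atTop (𝓝 R) := by
    refine tendsto_mul_integral_mul_pow (B := B) (continuousOn_mgf_neg (hX 0) (hX0 0)) (by simp)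
      (fun s _ => mgf_nonneg) (antitoneOn_mgf_neg (hX 0) (hX0 0))
      (fun s hs => mgf_neg_lt_one (hX 0) (hX0 0) (hpos 0) hs)
      (fun s hs => hasDerivAt_mgf_neg (hX 0) (hX0 0) hs) (fun s _ => hBnn s) ?_
      (by simpa using (hrep 0).1) (fun m => (hrep m).1) ?_
    · intro s hs
      exact mul_nonneg (Real.rpow_nonneg hs.le _) (integral_nonneg fun ω =>
        mul_nonneg (Real.rpow_nonneg (hX0 0 ω) _) (Real.exp_pos _).le)
    · intro ε hε
      filter_upwards [hratio.eventually (Metric.closedBall_mem_nhds R hε),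
        hratio.eventually (lt_mem_nhds hRpos)] with s h1 h2
      -- If B s were 0, the quotient A s / B s would be 0 by convention, against its being positive
      -- near 0.
      have hBs : 0 < B s := (hBnn s).lt_of_ne fun h => by simp [← h] at h2
      rw [Real.dist_eq] at h1
      calc |A s - R * B s| = |A s / B s - R| * B s := by
            rw [← abs_of_pos hBs, ← abs_mul, abs_of_pos hBs, sub_mul, div_mul_cancel₀ _ hBs.ne']
        _ ≤ ε * B s := by gcongr
  have hΓ : 0 < Real.Gamma γ := Real.Gamma_pos_of_pos hγ0
  have h3 := hmain.div_const (Real.Gamma γ)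
  rw [hR, div_div, mul_comm (Real.Gamma (1 - β))] at h3
  refine h3.congr fun m => ?_
  rw [(hrep m).2]
  field_simp

end SelfNormalizedSum

/-! ### From slow variation to tail ratios -/

section RegularVariation

theorem tendsto_div_of_isEquivalent_slowlyVarying {G ℓ : ℝ → ℝ} {α : ℝ} (hℓ : SlowlyVarying ℓ)
    (hG : G ~[atTop] fun x => ℓ x * x ^ (-α)) {c : ℝ} (hc : 0 < c) :
    Tendsto (fun x => G (c * x) / G x) atTop (𝓝 (c ^ (-α))) := by
  have h1 : Tendsto (fun x : ℝ => c * x) atTop atTop := tendsto_id.const_mul_atTop hc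
  have h2 := (hG.comp_tendsto h1).div hG
  refine h2.symm.tendsto_nhds ?_
  have h3 := (hℓ.2 c hc).mul_const (c ^ (-α))
  rw [one_mul] at h3
  refine h3.congr' ?_
  filter_upwards [eventually_gt_atTop 0] with x hx
  have : x ^ (-α) ≠ 0 := (Real.rpow_pos_of_pos hx _).ne'
  simp only [Function.comp_apply, Pi.div_apply]
  rw [Real.mul_rpow hc.le hx.le, ← mul_assoc, mul_div_mul_right _ _ this]
  ring

/-- Equivalence with an eventually positive function makes G positive arbitrarily far out;
monotonicity carries this back to every x. -/
theorem pos_of_antitone_of_isEquivalent {G ℓ : ℝ → ℝ} {α : ℝ} (hℓ : SlowlyVarying ℓ)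
    (hG : G ~[atTop] fun x => ℓ x * x ^ (-α)) (hanti : Antitone G) (hnn : ∀ x, 0 ≤ G x) (x : ℝ) :
    0 < G x := by
  obtain ⟨⟨X, hX, -⟩, -⟩ := hℓ
  have hne : ∀ᶠ x in atTop, ℓ x * x ^ (-α) ≠ 0 := by
    filter_upwards [eventually_ge_atTop X, eventually_gt_atTop 0] with y hy hy0
    exact (mul_pos (hX y hy) (Real.rpow_pos_of_pos hy0 _)).ne'
  have h1 := (isEquivalent_iff_tendsto_one hne).1 hG
  obtain ⟨y, hy, hxy⟩ := ((h1.eventually (lt_mem_nhds one_pos)).and (eventually_ge_atTop x)).exists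
  have hGy : 0 < G y := (hnn y).lt_of_ne fun h => by simp [← h] at hy
  exact hGy.trans_le (hanti hxy)

end RegularVariation

/-! ### Reduction to squares and conclusion -/

theorem abs_selfNormalized_rpow_two_mul {Ω : Type*} (Y : ℕ → Ω → ℝ) (k n : ℕ) (ω : Ω) (γ : ℝ) :
    |selfNormalized Y k n ω| ^ (2 * γ) =
      (Y k ω ^ 2 / ∑ i ∈ Finset.range n, Y i ω ^ 2) ^ γ := by
  rw [Real.rpow_mul (abs_nonneg _), Real.rpow_two, sq_abs, selfNormalized, selfNormalizer, div_pow,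
    Real.sq_sqrt (Finset.sum_nonneg fun i _ => sq_nonneg _)]

theorem mainTheorem7 {Ω : Type*} [MeasurableSpace Ω] (P : Measure Ω) [IsProbabilityMeasure P]
    (Y : ℕ → Ω → ℝ) (hmeas : ∀ i, Measurable (Y i)) (hindep : iIndepFun Y P)
    (hident : ∀ i, IdentDistrib (Y i) (Y 0) P P)
    (α : ℝ) (hα : α ∈ Set.Ioo (0 : ℝ) 2) (ℓ : ℝ → ℝ) (hℓ : SlowlyVarying ℓ)
    (htail : (fun x : ℝ => P.real {ω | x < |Y 0 ω|}) ~[atTop] (fun x : ℝ => ℓ x * x ^ (-α)))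
    (γ : ℝ) (hγ : 1 < γ) :
    (∀ n : ℕ, Integrable (fun ω => |selfNormalized Y 0 n ω| ^ (2 * γ)) P) ∧
      Tendsto (fun n : ℕ => (n : ℝ) * ∫ ω, |selfNormalized Y 0 n ω| ^ (2 * γ) ∂P) atTop
        (𝓝 (Real.Gamma (γ - α / 2) / (Real.Gamma γ * Real.Gamma (1 - α / 2)))) := by
  obtain ⟨hα0, hα2⟩ := hα
  have hX : ∀ i, Measurable fun ω => Y i ω ^ 2 := fun i => (hmeas i).pow_const 2
  have hX0 : ∀ i ω, 0 ≤ Y i ω ^ 2 := fun i ω => sq_nonneg _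
  have hpos := pos_of_antitone_of_isEquivalent hℓ htail
    (antitone_measureReal_lt fun ω => |Y 0 ω|) (fun x => measureReal_nonneg)
  have hset : ∀ x, 0 ≤ x → {ω | x < Y 0 ω ^ 2} = {ω | √x < |Y 0 ω|} := by
    intro x hx
    ext ω
    simp only [Set.mem_ofPred_eq]
    rw [← Real.sqrt_sq_eq_abs, Real.sqrt_lt_sqrt_iff hx]
  have hpos2 : ∀ x, 0 < P.real {ω | x < Y 0 ω ^ 2} := by
    intro x
    -- The square-root form of the event needs a nonnegative level, so a negative x is first raised
    -- to 0.
    refine lt_of_lt_of_le ?_ (antitone_measureReal_lt (fun ω => Y 0 ω ^ 2) (le_max_left x 0))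
    simp only [hset _ (le_max_right x 0)]
    exact hpos _
  have hlim : ∀ c, 0 < c → Tendsto (fun x => P.real {ω | c * x < Y 0 ω ^ 2} /
      P.real {ω | x < Y 0 ω ^ 2}) atTop (𝓝 (c ^ (-(α / 2)))) := by
    intro c hc
    have h1 := (tendsto_div_of_isEquivalent_slowlyVarying hℓ htail (Real.sqrt_pos.2 hc)).comp
      Real.tendsto_sqrt_atTop
    have e : √c ^ (-α) = c ^ (-(α / 2)) := by
      rw [Real.sqrt_eq_rpow, ← Real.rpow_mul hc.le]
      ring_nf
    rw [e] at h1
    refine h1.congr' ?_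
    filter_upwards [eventually_ge_atTop 0] with x hx
    simp only [Function.comp_apply]
    rw [hset _ (by positivity), hset _ hx, Real.sqrt_mul hc.le]
  simp only [abs_selfNormalized_rpow_two_mul]
  refine ⟨fun n => ?_, ?_⟩
  · cases n with
    | zero => simp [Real.zero_rpow (by linarith : γ ≠ 0)]
    | succ m => exact integrable_div_sum_rpow (X := fun i ω => Y i ω ^ 2) hX hX0 (by linarith) m
  -- With n = m + 1 summands, one is X_0 and the other m give the power φ^m.
  · rw [← tendsto_add_atTop_iff_nat 1]
    have := tendsto_nat_mul_integral_div_sum_rpow (X := fun i ω => Y i ω ^ 2) hX hX0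
      (hindep.comp (fun _ x => x ^ 2) fun _ => by fun_prop)
      (fun i => (hident i).comp (u := fun x => x ^ 2) (by fun_prop)) hpos2
      (by linarith) (by linarith) hlim hγ.le
    simpa only [Nat.cast_add, Nat.cast_one] using this
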